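/- **Theorem.** Let $n\ge 0$, and let $L_n$ be the ladder poset: it has the elements $-n,\dots,n+1$, with $x<y$ if and only if $|x|<|y|$. Thus $\hat 0=0$, $\hat 1=n+1$, there are exactly two elements $\pm i$ of each rank $0<i<n+1$, and any two elements of different ranks are comparable. For a graded poset $P$ of rank $m+1$ let $\Psi_P=\sum_{S\subseteq\{1,\dots,m\}} f_S(P)\,w_1\cdots w_m\in\mathbb Q\langle a,b\rangle$ be its $ab$-index, where $f_S(P)$ is the number of chains of $P$ with rank set $S$, and $w_i=b$ if $i\in S$, $w_i=a-b$ if $i\notin S$. Let $$\Psi_{\mathcal I_2(L_n)}=\sum_{x\in L_n}\Psi_{[[x,x],[\hat 0,\hat 1]]}$$ be the total $ab$-index of the interval transform of the second kind of $L_n$; here $[[x,x],[\hat 0,\hat 1]]$ is the poset of all intervals $[y,z]$ of $L_n$ that contain $x$, ordered by inclusion. Let $\mathcal I_2$ also denote the linear operator on $\mathbb Q\langle a,b\rangle$ given on $ab$-words $u=u_1\cdots u_k$ by $$\mathcal I_2(u)=u+u^*+\sum_{i=1}^{k} M\big((u_1\cdots u_{i-1})^*,\,u_{i+1}\cdots u_k\big),$$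 where $^*$ reverses words and $M$ is the mixing operator of Ehrenborg and Readdy: $M(u,v)=\sum_{r,s\in\{1,2\}}\sum_{m\ge 2}M_{r,s,m}(u,v)$ with $M_{1,2,2}(u,v)=u\,a\,v$, $M_{2,1,2}(u,v)=v\,b\,u$, $M_{1,1,2}=M_{2,2,2}=0$, $M_{1,s,m+1}(u,v)=\sum_i u_1\cdots u_{i-1}\,a\,M_{2,s,m}(u_{i+1}\cdots u_k,v)$ and $M_{2,s,m+1}(u,v)=\sum_i v_1\cdots v_{i-1}\,b\,M_{1,s,m}(u,v_{i+1}\cdots v_l)$ for words $u=u_1\cdots u_k$, $v=v_1\cdots v_l$. Put $c=a+b$, $d=ab+ba$, $e=a-b$. Then $\mathcal I_2(c^n)=\Psi_{\mathcal I_2(L_n)}$, and this element can be written in exactly one way as a noncommutative polynomial in $c$ and $d$, and in exactly one way as a noncommutative polynomial in $c$ and $e$. For all nonnegative integers $r,k_0,\dots,k_r$ with $2r+k_0+k_1+\cdots+k_r=n$: 1. the coefficient of $c^{k_0}dc^{k_1}d\cdots dc^{k_r}$ in $\mathcal I_2(c^n)$, written as a $cd$-polynomial, is $2^{r+1}(k_0+1)(k_1+1)\cdots(k_r+1)$;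 2. the coefficient of $c^{k_0}e^2c^{k_1}e^2\cdots e^2c^{k_r}$ in $\mathcal I_2(c^n)$, written as a $ce$-polynomial, is $(-1)^r2^{n+1-2r}$. -/

import Mathlib

noncomputable section

/-! ### Noncommutative polynomials -/

/-- The two noncommuting letters `a`, `b`. -/
inductive ABLetter where
  | a
  | b

/-- The two noncommuting letters `c`, `d`. -/
inductive CDLetter where
  | c
  | d

/-- The two noncommuting letters `c`, `e`. -/
inductive CELetter where
  | c
  | e

/-- The algebra `ℚ⟨a, b⟩`. -/
abbrev ABPoly : Type := FreeAlgebra ℚ ABLetter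

/-- The algebra `ℚ⟨c, d⟩`. -/
abbrev CDPoly : Type := FreeAlgebra ℚ CDLetter

/-- The algebra `ℚ⟨c, e⟩`. -/
abbrev CEPoly : Type := FreeAlgebra ℚ CELetter

/-- The coefficient of the word `w` in the noncommutative polynomial `p`. -/
def wordCoeff {X : Type} (w : List X) (p : FreeAlgebra ℚ X) : ℚ :=
  (FreeAlgebra.basisFreeMonoid ℚ X).repr p (FreeMonoid.ofList w)

namespace ABPoly

/-- The variable `a`. -/
def a : ABPoly := FreeAlgebra.ι ℚ ABLetter.a

/-- The variable `b`. -/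
def b : ABPoly := FreeAlgebra.ι ℚ ABLetter.b

/-- `c = a + b`. -/
def c : ABPoly := a + b

/-- `d = ab + ba`. -/
def d : ABPoly := a * b + b * a

/-- `e = a - b`. -/
def e : ABPoly := a - b

/-- The monomial in `a` and `b` spelled by a word. -/
def word (w : List ABLetter) : ABPoly := (w.map (FreeAlgebra.ι ℚ)).prod

end ABPoly

/-- Substitute `c = a + b` and `d = ab + ba` into a `cd`-polynomial. -/
def cdToAB : CDPoly →ₐ[ℚ] ABPoly :=
  FreeAlgebra.lift ℚ fun
    | CDLetter.c => ABPoly.c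
    | CDLetter.d => ABPoly.d

/-- Substitute `c = a + b` and `e = a - b` into a `ce`-polynomial. -/
def ceToAB : CEPoly →ₐ[ℚ] ABPoly :=
  FreeAlgebra.lift ℚ fun
    | CELetter.c => ABPoly.c
    | CELetter.e => ABPoly.e

/-- The word `c^{k₀} d c^{k₁} d ⋯ d c^{k_r}`. -/
def cdWord {r : ℕ} (k : Fin (r + 1) → ℕ) : List CDLetter :=
  List.intercalate [CDLetter.d] (List.ofFn fun i => List.replicate (k i) CDLetter.c)

/-- The word `c^{k₀} e² c^{k₁} e² ⋯ e² c^{k_r}`. -/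
def ceWord {r : ℕ} (k : Fin (r + 1) → ℕ) : List CELetter :=
  List.intercalate [CELetter.e, CELetter.e]
    (List.ofFn fun i => List.replicate (k i) CELetter.c)

/-! ### The `ab`-index of a graded poset -/

/-- The rank of an element: the maximal length of a chain descending from it.  In a finite graded
poset with minimum element this is the value of its rank function. -/
def posetRank {P : Type*} [PartialOrder P] (x : P) : ℕ := (Order.height x).toNat

/-- The flag number `f_S(P)`: the number of chains of `P` whose set of ranks is `S`. -/
def flagF (P : Type*) [PartialOrder P] (S : Finset ℕ) : ℕ :=
  Nat.card {C : Finset P // IsChain (· ≤ ·) (C : Set P) ∧ C.image posetRank = S}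

/-- The upsilon invariant `Υ_P(s, t) = ∑_S f_S u_S` of a graded poset `P` of rank `n + 1`, evaluated
at elements `s, t` of `ℚ⟨a, b⟩`.  Here `S` runs over the subsets of `{1, …, n}`, and `u_S` is
the product `u₁ ⋯ u_n` with `u_i = t` for `i ∈ S` and `u_i = s` for `i ∉ S`. -/
def upsilon (P : Type*) [PartialOrder P] [OrderTop P] (s t : ABPoly) : ABPoly :=
  ∑ S ∈ (Finset.Icc 1 (posetRank (⊤ : P) - 1)).powerset,
    (flagF P S : ℚ) •
      ((List.range (posetRank (⊤ : P) - 1)).map fun i => if i + 1 ∈ S then t else s).prod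

/-- The `ab`-index `Ψ_P(a, b) = Υ_P(a - b, b)`. -/
def abIndex (P : Type*) [PartialOrder P] [OrderTop P] : ABPoly :=
  upsilon P (ABPoly.a - ABPoly.b) ABPoly.b

/-! ### The interval transform of the second kind -/

/-- The member of the interval transform of the second kind of `P` that belongs to `x`: the
intervals of `P` that contain `[x, x]`, ordered by inclusion. -/
abbrev IntervalsAround {P : Type*} [PartialOrder P] (x : P) : Type _ :=
  Set.Ici (NonemptyInterval.pure x)

/-- The total `ab`-index of the interval transform of the second kind of `P`: the sum of the
`ab`-indices of its members. -/
def totalABIndex (P : Type*) [PartialOrder P] [BoundedOrder P] [Fintype P] : ABPoly :=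
  ∑ x : P, abIndex (IntervalsAround x)

/-- `mixTerm m r s u v` is the term `M_{r,s,m+2}(u, v)` of the mixing operator on `ab`-words, where
`r, s ∈ {1, 2}`.  The coproduct of a word `u₁ ⋯ u_k` is `∑ i, u₁ ⋯ u_{i-1} ⊗ u_{i+1} ⋯ u_k`. -/
def mixTerm : ℕ → ℕ → ℕ → List ABLetter → List ABLetter → ABPoly
  | 0, 1, 2, u, v => ABPoly.word u * ABPoly.a * ABPoly.word v
  | 0, 2, 1, u, v => ABPoly.word v * ABPoly.b * ABPoly.word u
  | m + 1, 1, s, u, v =>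
      ∑ i ∈ Finset.range u.length,
        ABPoly.word (u.take i) * ABPoly.a * mixTerm m 2 s (u.drop (i + 1)) v
  | m + 1, 2, s, u, v =>
      ∑ i ∈ Finset.range v.length,
        ABPoly.word (v.take i) * ABPoly.b * mixTerm m 1 s u (v.drop (i + 1))
  | _, _, _, _, _ => 0

/-- The mixing operator `M(u, v)` on `ab`-words.  Every step of the recursion removes a letter, so
that `M_{r,s,m+2}(u, v) = 0` for `m` larger than the total length of the two words; it also
vanishes unless `m + 1 + r + s` is even. -/
def mix (u v : List ABLetter) : ABPoly :=
  ∑ r ∈ Finset.Icc 1 2, ∑ s ∈ Finset.Icc 1 2, ∑ m ∈ Finset.range (u.length + v.length + 1),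
    mixTerm m r s u v

/-- The linear operator on `ℚ⟨a, b⟩` given on `ab`-words by
`u ↦ u + u^* + ∑_u M(u_{(1)}^*, u_{(2)})`, where `^*` reverses words. -/
def intervalOpII : ABPoly →ₗ[ℚ] ABPoly :=
  (FreeAlgebra.basisFreeMonoid ℚ ABLetter).constr ℚ fun w =>
    ABPoly.word w.toList + ABPoly.word w.toList.reverse +
      ∑ i ∈ Finset.range w.toList.length,
        mix (w.toList.take i).reverse (w.toList.drop (i + 1))

/-! ### The ladder poset -/

/-- The ladder poset `L_n`, on the integers `-n, …, n + 1`.  The element `0` is the minimum, `n + 1`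
is the maximum, and for `0 < i < n + 1` the elements of rank `i` are `-i` and `i`. -/
def Ladder (n : ℕ) : Type := Set.Icc (-(n : ℤ)) ((n : ℤ) + 1)

namespace Ladder

variable {n : ℕ}

/-- The integer that names an element of the ladder. -/
def val (x : Ladder n) : ℤ := Subtype.val x

instance : Fintype (Ladder n) :=
  inferInstanceAs (Fintype (Set.Icc (-(n : ℤ)) ((n : ℤ) + 1)))

/-- Any two elements of different ranks are comparable. -/
instance : PartialOrder (Ladder n) where
  le x y := x = y ∨ |x.val| < |y.val|
  le_refl x := Or.inl rfl
  le_trans x y z := by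
    rintro (rfl | h) (rfl | h')
    · exact Or.inl rfl
    · exact Or.inr h'
    · exact Or.inr h
    · exact Or.inr (h.trans h')
  le_antisymm x y := by
    rintro (rfl | h) (h' | h')
    · rfl
    · rfl
    · exact h'.symm
    · exact absurd h' h.asymm

instance : BoundedOrder (Ladder n) where
  bot := ⟨0, by constructor <;> omega⟩
  top := ⟨(n : ℤ) + 1, by constructor <;> omega⟩
  bot_le x := by
    rcases eq_or_ne x.val 0 with h | h
    · exact Or.inl (Subtype.ext h.symm)
    · exact Or.inr (by simpa [val] using h)
  le_top x := by
    have h1 : -(n : ℤ) ≤ x.val := x.2.1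
    have h2 : x.val ≤ (n : ℤ) + 1 := x.2.2
    rcases eq_or_ne x.val ((n : ℤ) + 1) with h | h
    · exact Or.inl (Subtype.ext h)
    · refine Or.inr ?_
      change |x.val| < |(n : ℤ) + 1|
      rw [abs_of_nonneg (by omega : (0 : ℤ) ≤ (n : ℤ) + 1), abs_lt]
      omega

end Ladder

end

/-! Both sides equal `2 * lucas n`, where V₀ = 1, V₁ = 2c and V_{n+2} = 2c V_{n+1} - e² V_n;
coefficients and uniqueness are then read off from this recurrence.

Operator side. Since c^n is the sum of all words of length n, the mixing operator need only be known
on pairs (c^i, c^j), where deleting a letter contributes a factor 2. Let A_n, B_n be the sums over i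
+ j = n of the terms of M with r = 1 and r = 2. Peeling off first letters gives a linear recursion
for (A_n, B_n), and in terms of A + B and A - B it becomes the recurrence for V
(`lucas_succ_eq_mixPowSum`).

Poset side. In the poset of intervals around x, the chains below [y, z] depend only on the rank
distances i, j from x to y and z. Removing the maximum of a chain gives a recursion for the ab-index
of the lower interval (`chainSum_eq`). A rank distance strictly between 0 and i is realised by two
elements of the ladder, each of the distances 0 and i by one; weights 1/2 absorb this, and the
solution becomes a multiple of U(i-1, j) + U(i, j-1) for the lattice-path array U = `grid`
(`chainSum_around`). Summing over x sums U over an antidiagonal, which satisfies the recurrence of V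
with the multiplications on the right; V satisfies both forms (`lucas_add_two'`).

Coefficients. In the letters c, e a leading c contributes 2 and a leading e² contributes -1. Since
e² = c² - 2d, in the letters c, d a leading d contributes 2, while the coefficients along c^k
satisfy x_{k+2} = 2x_{k+1} - x_k and so grow linearly in k. Uniqueness is the injectivity of the two
substitutions into ℚ⟨a, b⟩. -/

noncomputable section

namespace ABPoly

/-! ### Words -/

/-- The monomial of a single letter. -/
abbrev letter (x : ABLetter) : ABPoly := FreeAlgebra.ι ℚ x

@[simp] theorem word_nil : word [] = 1 := by simp [word]

@[simp] theorem word_cons (x : ABLetter) (w : List ABLetter) :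
    word (x :: w) = letter x * word w := by simp [word]

theorem letter_a : letter ABLetter.a = a := rfl

theorem letter_b : letter ABLetter.b = b := rfl

/-- The sum of `f` over all words of length `n`. -/
def sumWords {A : Type*} [AddCommMonoid A] : ℕ → (List ABLetter → A) → A
  | 0, f => f []
  | n + 1, f => sumWords n (fun w => f (ABLetter.a :: w)) + sumWords n (fun w => f (ABLetter.b :: w))

section sumWords

variable {A B : Type*} [AddCommMonoid A] [AddCommMonoid B]

theorem sumWords_congr {n : ℕ} {f g : List ABLetter → A} (h : ∀ w, w.length = n → f w = g w) :
    sumWords n f = sumWords n g := by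
  induction n generalizing f g with
  | zero => exact h [] rfl
  | succ n ih =>
    simp only [sumWords]
    rw [ih fun w hw => h _ (by simp [hw]), ih fun w hw => h _ (by simp [hw])]

theorem sumWords_add (n : ℕ) (f g : List ABLetter → A) :
    sumWords n (fun w => f w + g w) = sumWords n f + sumWords n g := by
  induction n generalizing f g with
  | zero => rfl
  | succ n ih => simp only [sumWords, ih]; abel

theorem sumWords_zero (n : ℕ) : sumWords n (fun _ => (0 : A)) = 0 := by
  induction n with
  | zero => rfl
  | succ n ih => simp [sumWords, ih]

theorem map_sumWords (φ : A →+ B) (n : ℕ) (f : List ABLetter → A) :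
    φ (sumWords n f) = sumWords n (fun w => φ (f w)) := by
  induction n generalizing f with
  | zero => rfl
  | succ n ih => simp only [sumWords, map_add, ih]

theorem sumWords_append (m n : ℕ) (f : List ABLetter → A) :
    sumWords (m + n) f = sumWords m (fun u => sumWords n (fun v => f (u ++ v))) := by
  induction m generalizing f with
  | zero => simp [sumWords]
  | succ m ih =>
    rw [Nat.succ_add]
    simp only [sumWords, ih, List.cons_append]

theorem sumWords_reverse (n : ℕ) (f : List ABLetter → A) :
    sumWords n (fun w => f w.reverse) = sumWords n f := by
  induction n generalizing f with
  | zero => rfl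
  | succ n ih =>
    conv_lhs => rw [sumWords_append n 1]
    simp only [sumWords, List.reverse_append, List.reverse_singleton, List.singleton_append,
      sumWords_add]
    rw [ih fun w => f (ABLetter.a :: w), ih fun w => f (ABLetter.b :: w)]

theorem sumWords_sum {ι : Type*} (s : Finset ι) (n : ℕ) (f : ι → List ABLetter → A) :
    sumWords n (fun w => ∑ i ∈ s, f i w) = ∑ i ∈ s, sumWords n (f i) := by
  classical
  induction s using Finset.induction_on with
  | empty => simp [sumWords_zero]
  | insert i s hi ih => simp only [Finset.sum_insert hi, sumWords_add, ih]

end sumWords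

theorem mul_sumWords (p : ABPoly) (n : ℕ) (f : List ABLetter → ABPoly) :
    sumWords n (fun w => p * f w) = p * sumWords n f :=
  (map_sumWords (AddMonoidHom.mulLeft p) n f).symm

theorem sumWords_word (n : ℕ) : sumWords n word = c ^ n := by
  induction n with
  | zero => simp [sumWords]
  | succ n ih =>
    simp only [sumWords, word_cons, mul_sumWords, ih, letter_a, letter_b]
    rw [pow_succ', c, add_mul]

/-- Summing over the words of length `i + 1 + j`, split at position `i`. -/
theorem sumWords_split (i j : ℕ) (F : List ABLetter → List ABLetter → ABPoly) :
    sumWords (i + (j + 1)) (fun w => F (w.take i) (w.drop (i + 1))) =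
      2 * sumWords i (fun u => sumWords j (F u)) := by
  rw [sumWords_append, ← mul_sumWords]
  refine sumWords_congr fun u hu => ?_
  have h1 (v : List ABLetter) : (u ++ v).take i = u := by simp [← hu]
  have h2 (x : ABLetter) (v : List ABLetter) : (u ++ x :: v).drop (i + 1) = v := by
    rw [← hu]; simp [List.drop_append]
  simp only [sumWords, h1, h2, two_mul]

/-! ### The mixing operator on powers of `c` -/

theorem mixTerm_eq_zero (m r s : ℕ) (u v : List ABLetter) (h : u.length + v.length < m) :
    mixTerm m r s u v = 0 := by
  induction m generalizing r u v with
  | zero => omega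
  | succ m ih =>
    match r with
    | 0 => rw [mixTerm] <;> simp
    | 1 =>
      rw [mixTerm]
      refine Finset.sum_eq_zero fun i hi => ?_
      rw [Finset.mem_range] at hi
      rw [ih _ _ _ (by rw [List.length_drop]; omega), mul_zero]
    | 2 =>
      rw [mixTerm]
      refine Finset.sum_eq_zero fun i hi => ?_
      rw [Finset.mem_range] at hi
      rw [ih _ _ _ (by rw [List.length_drop]; omega), mul_zero]
    | r + 3 => rw [mixTerm] <;> simp

/-- The sum of the terms `M_{r,s,m}` of the mixing operator over all `s` and `m`. -/
def mixFrom (r : ℕ) (u v : List ABLetter) : ABPoly :=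
  ∑ s ∈ Finset.Icc 1 2, ∑ m ∈ Finset.range (u.length + v.length + 1), mixTerm m r s u v

/-- The terms beyond the total length vanish, so sums for words of different lengths can be given a
common range before they are compared. -/
theorem mixFrom_eq (r N : ℕ) (u v : List ABLetter) (h : u.length + v.length < N) :
    mixFrom r u v = ∑ m ∈ Finset.range N, (mixTerm m r 1 u v + mixTerm m r 2 u v) := by
  have h12 : Finset.Icc 1 2 = ({1, 2} : Finset ℕ) := rfl
  rw [mixFrom, h12, Finset.sum_pair (by simp), ← Finset.sum_add_distrib]
  refine Finset.sum_subset (Finset.range_subset_range.2 h) fun m _ hm => ?_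
  have : u.length + v.length < m := by simpa using hm
  rw [mixTerm_eq_zero _ _ _ _ _ this, mixTerm_eq_zero _ _ _ _ _ this, add_zero]

theorem mix_eq (u v : List ABLetter) : mix u v = mixFrom 1 u v + mixFrom 2 u v := by
  have h12 : Finset.Icc 1 2 = ({1, 2} : Finset ℕ) := rfl
  rw [mix, h12, Finset.sum_pair (by simp)]
  rfl

theorem mixTerm_zero_one (u v : List ABLetter) :
    mixTerm 0 1 1 u v + mixTerm 0 1 2 u v = word u * a * word v := by
  simp [mixTerm]

theorem mixTerm_zero_two (u v : List ABLetter) :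
    mixTerm 0 2 1 u v + mixTerm 0 2 2 u v = word v * b * word u := by
  simp [mixTerm]

theorem mixTerm_one_nil (m s : ℕ) (v : List ABLetter) : mixTerm (m + 1) 1 s [] v = 0 := by
  simp [mixTerm]

theorem mixTerm_two_nil (m s : ℕ) (u : List ABLetter) : mixTerm (m + 1) 2 s u [] = 0 := by
  simp [mixTerm]

theorem mixTerm_one_cons (m s : ℕ) (x : ABLetter) (u v : List ABLetter) :
    mixTerm (m + 1) 1 s (x :: u) v =
      letter x * mixTerm (m + 1) 1 s u v + a * mixTerm m 2 s u v := by
  rw [mixTerm, List.length_cons, Finset.sum_range_succ', mixTerm]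
  simp [Finset.mul_sum, mul_assoc]

theorem mixTerm_two_cons (m s : ℕ) (x : ABLetter) (u v : List ABLetter) :
    mixTerm (m + 1) 2 s u (x :: v) =
      letter x * mixTerm (m + 1) 2 s u v + b * mixTerm m 1 s u v := by
  rw [mixTerm, List.length_cons, Finset.sum_range_succ', mixTerm]
  simp [Finset.mul_sum, mul_assoc]

theorem mixFrom_one_nil (v : List ABLetter) : mixFrom 1 [] v = a * word v := by
  rw [mixFrom_eq 1 (v.length + 1) [] v (by simp), Finset.sum_range_succ', mixTerm_zero_one]
  simp [mixTerm_one_nil]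

theorem mixFrom_two_nil (u : List ABLetter) : mixFrom 2 u [] = b * word u := by
  rw [mixFrom_eq 2 (u.length + 1) u [] (by simp), Finset.sum_range_succ', mixTerm_zero_two]
  simp [mixTerm_two_nil]

/-- The deleted letter of `x :: u` is either `x`, which leaves `a` followed by a term with r = 2, or
a later letter, and then `x` stays in front. -/
theorem mixFrom_one_cons (x : ABLetter) (u v : List ABLetter) :
    mixFrom 1 (x :: u) v = letter x * mixFrom 1 u v + a * mixFrom 2 u v := by
  rw [mixFrom_eq 1 (u.length + v.length + 1 + 1) (x :: u) v (by simp; omega),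
    mixFrom_eq 1 (u.length + v.length + 1 + 1) u v (by omega),
    mixFrom_eq 2 (u.length + v.length + 1) u v (by omega),
    Finset.sum_range_succ' _ (u.length + v.length + 1),
    Finset.sum_range_succ' _ (u.length + v.length + 1), mixTerm_zero_one, mixTerm_zero_one]
  simp only [mixTerm_one_cons, Finset.sum_add_distrib, ← Finset.mul_sum, word_cons, mul_add,
    mul_assoc]
  abel

theorem mixFrom_two_cons (x : ABLetter) (u v : List ABLetter) :
    mixFrom 2 u (x :: v) = letter x * mixFrom 2 u v + b * mixFrom 1 u v := by
  rw [mixFrom_eq 2 (u.length + v.length + 1 + 1) u (x :: v) (by simp; omega),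
    mixFrom_eq 2 (u.length + v.length + 1 + 1) u v (by omega),
    mixFrom_eq 1 (u.length + v.length + 1) u v (by omega),
    Finset.sum_range_succ' _ (u.length + v.length + 1),
    Finset.sum_range_succ' _ (u.length + v.length + 1), mixTerm_zero_two, mixTerm_zero_two]
  simp only [mixTerm_two_cons, Finset.sum_add_distrib, ← Finset.mul_sum, word_cons, mul_add,
    mul_assoc]
  abel

/-- `mixFrom r` evaluated at `(c ^ i, c ^ j)`. -/
def mixPow (r i j : ℕ) : ABPoly := sumWords i fun u => sumWords j fun v => mixFrom r u v

theorem mixPow_one_zero (j : ℕ) : mixPow 1 0 j = a * c ^ j := by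
  simp only [mixPow, sumWords, mixFrom_one_nil, mul_sumWords]
  rw [← sumWords_word]

theorem mixPow_two_zero (i : ℕ) : mixPow 2 i 0 = b * c ^ i := by
  simp only [mixPow, sumWords, mixFrom_two_nil, mul_sumWords]
  rw [← sumWords_word]

/-- A retained first letter sums to c; a deleted one can be either of two letters, whence the factor
2. -/
theorem mixPow_one_succ (i j : ℕ) :
    mixPow 1 (i + 1) j = c * mixPow 1 i j + 2 * (a * mixPow 2 i j) := by
  simp only [mixPow, sumWords, mixFrom_one_cons, sumWords_add, mul_sumWords, letter_a, letter_b, c]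
  noncomm_ring

theorem mixPow_two_succ (i j : ℕ) :
    mixPow 2 i (j + 1) = c * mixPow 2 i j + 2 * (b * mixPow 1 i j) := by
  simp only [mixPow, sumWords, mixFrom_two_cons, sumWords_add, mul_sumWords, letter_a, letter_b, c]
  noncomm_ring

/-- The sum of `mixPow r i j` over all `i + j = n`. -/
def mixPowSum (r n : ℕ) : ABPoly := ∑ p ∈ Finset.HasAntidiagonal.antidiagonal n, mixPow r p.1 p.2

theorem mixPowSum_one_succ (n : ℕ) :
    mixPowSum 1 (n + 1) = a * c ^ (n + 1) + c * mixPowSum 1 n + 2 * (a * mixPowSum 2 n) := by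
  simp only [mixPowSum, Finset.Nat.sum_antidiagonal_succ, mixPow_one_zero, mixPow_one_succ,
    Finset.sum_add_distrib, Finset.mul_sum, add_assoc]

theorem mixPowSum_two_succ (n : ℕ) :
    mixPowSum 2 (n + 1) = b * c ^ (n + 1) + c * mixPowSum 2 n + 2 * (b * mixPowSum 1 n) := by
  simp only [mixPowSum, Finset.Nat.sum_antidiagonal_succ', mixPow_two_zero, mixPow_two_succ,
    Finset.sum_add_distrib, Finset.mul_sum]
  abel

/-! ### The operator on powers of c and the recurrence for V -/

theorem intervalOpII_word (w : List ABLetter) :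
    intervalOpII (word w) = word w + word w.reverse +
      ∑ i ∈ Finset.range w.length, mix (w.take i).reverse (w.drop (i + 1)) := by
  have h : word w = FreeAlgebra.basisFreeMonoid ℚ ABLetter (FreeMonoid.ofList w) := by
    simp [word, FreeAlgebra.basisFreeMonoid, FreeAlgebra.equivMonoidAlgebraFreeMonoid,
      MonoidAlgebra.lift_single, FreeMonoid.lift_apply]
  conv_lhs => rw [h]
  rw [intervalOpII, Module.Basis.constr_basis]
  rfl

theorem intervalOpII_c_pow (n : ℕ) :
    intervalOpII (c ^ n) = 2 * c ^ n +
      ∑ i ∈ Finset.range n, 2 * (mixPow 1 i (n - 1 - i) + mixPow 2 i (n - 1 - i)) := by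
  rw [← sumWords_word]
  have h1 : intervalOpII (sumWords n word) = sumWords n fun w => intervalOpII (word w) :=
    map_sumWords intervalOpII.toAddMonoidHom n word
  have h2 : (sumWords n fun w => intervalOpII (word w)) = sumWords n fun w =>
      word w + word w.reverse + ∑ i ∈ Finset.range n, mix (w.take i).reverse (w.drop (i + 1)) := by
    refine sumWords_congr fun w hw => ?_
    rw [intervalOpII_word, hw]
  rw [h1, h2, sumWords_add, sumWords_add, sumWords_reverse n word, sumWords_sum, two_mul]
  congr 1
  refine Finset.sum_congr rfl fun i hi => ?_
  obtain ⟨j, rfl⟩ : ∃ j, n = i + (j + 1) := ⟨n - i - 1, by have := Finset.mem_range.1 hi; omega⟩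
  -- Reversal permutes the words of length `i`, so it disappears from the sum.
  rw [sumWords_split i j fun u v => mix u.reverse v,
    sumWords_reverse i fun u => sumWords j fun v => mix u v]
  simp only [mix_eq, sumWords_add]
  rw [show i + (j + 1) - 1 - i = j by omega]
  rfl

/-- The noncommutative Lucas-type sequence `V₀ = 1`, `V₁ = 2c`, `V_{n+2} = 2c V_{n+1} - e² V_n`. -/
def lucas : ℕ → ABPoly
  | 0 => 1
  | 1 => 2 * c
  | n + 2 => 2 * c * lucas (n + 1) - e ^ 2 * lucas n

/-- The mixing operator builds words from the left, the chain recursion from the right; this form of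
the recurrence lets the two be compared. -/
theorem lucas_add_two' (n : ℕ) : lucas (n + 2) = lucas (n + 1) * (2 * c) - lucas n * e ^ 2 := by
  induction n using Nat.twoStepInduction with
  | zero => simp [lucas]
  | one => simp only [lucas]; noncomm_ring
  | more n ih1 ih2 =>
    have h (m : ℕ) : lucas (m + 2) = 2 * c * lucas (m + 1) - e ^ 2 * lucas m := rfl
    calc lucas (n + 2 + 2)
        = 2 * c * (lucas (n + 2) * (2 * c) - lucas (n + 1) * e ^ 2)
          - e ^ 2 * (lucas (n + 1) * (2 * c) - lucas n * e ^ 2) := by rw [← ih1, ← ih2, h (n + 2)]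
      _ = (2 * c * lucas (n + 2) - e ^ 2 * lucas (n + 1)) * (2 * c)
          - (2 * c * lucas (n + 1) - e ^ 2 * lucas n) * e ^ 2 := by noncomm_ring
      _ = lucas (n + 2 + 1) * (2 * c) - lucas (n + 2) * e ^ 2 := by rw [← h n, ← h (n + 1)]

/-- With A and B the two sums, 2(aB + bA) = c(A + B) - e(A - B) and c(A - B) + 2(aB - bA) = e(A +
B). Hence sum and difference determine each other's next values. -/
theorem lucas_succ_eq_mixPowSum (n : ℕ) :
    lucas (n + 1) = c ^ (n + 1) + (mixPowSum 1 n + mixPowSum 2 n) ∧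
      mixPowSum 1 n - mixPowSum 2 n = e * lucas n := by
  have h0 : mixPowSum 1 0 = a ∧ mixPowSum 2 0 = b := by
    simp [mixPowSum, mixPow_one_zero, mixPow_two_zero]
  have h (n : ℕ) (h1 : lucas (n + 1) = c ^ (n + 1) + (mixPowSum 1 n + mixPowSum 2 n)) :
      mixPowSum 1 (n + 1) - mixPowSum 2 (n + 1) = e * lucas (n + 1) := by
    rw [mixPowSum_one_succ, mixPowSum_two_succ, h1]
    -- Keeps the power of `c` opaque while `c` and `e` are expanded in `a` and `b`.
    generalize c ^ (n + 1) = z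
    simp only [c, e]
    noncomm_ring
  induction n with
  | zero =>
    rw [h0.1, h0.2]
    simp [lucas, c, e, two_mul]
  | succ n ih =>
    refine ⟨?_, h n ih.1⟩
    have h2 : e ^ 2 * lucas n = e * (mixPowSum 1 n - mixPowSum 2 n) := by rw [ih.2]; noncomm_ring
    rw [lucas, h2, ih.1, mixPowSum_one_succ, mixPowSum_two_succ, pow_succ' c (n + 1)]
    generalize c ^ (n + 1) = z
    simp only [c, e]
    noncomm_ring

theorem intervalOpII_c_pow_eq_lucas (n : ℕ) : intervalOpII (c ^ n) = 2 * lucas n := by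
  rw [intervalOpII_c_pow]
  cases n with
  | zero => simp [lucas]
  | succ n =>
    rw [(lucas_succ_eq_mixPowSum n).1, mixPowSum, mixPowSum, ← Finset.sum_add_distrib,
      Finset.Nat.sum_antidiagonal_eq_sum_range_succ_mk, mul_add, Finset.mul_sum]
    simp

end ABPoly

/-! ### Word coefficients -/

section FreeAlgebra

variable {X : Type}

/-- The monomial in the free algebra spelled by a word. -/
def monomialWord (w : List X) : FreeAlgebra ℚ X := (w.map (FreeAlgebra.ι ℚ)).prod

@[simp] theorem monomialWord_nil : monomialWord ([] : List X) = 1 := by simp [monomialWord]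

@[simp] theorem monomialWord_cons (x : X) (w : List X) :
    monomialWord (x :: w) = FreeAlgebra.ι ℚ x * monomialWord w := by simp [monomialWord]

theorem basisFreeMonoid_apply (w : FreeMonoid X) :
    FreeAlgebra.basisFreeMonoid ℚ X w = monomialWord w.toList := by
  simp [monomialWord, FreeAlgebra.basisFreeMonoid, FreeAlgebra.equivMonoidAlgebraFreeMonoid,
    MonoidAlgebra.lift_single, FreeMonoid.lift_apply]

/-- Linear maps on a free algebra that agree on monomials are equal. -/
theorem linearMap_ext_monomialWord {M : Type*} [AddCommMonoid M] [Module ℚ M]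
    {f g : FreeAlgebra ℚ X →ₗ[ℚ] M} (h : ∀ w, f (monomialWord w) = g (monomialWord w)) : f = g :=
  (FreeAlgebra.basisFreeMonoid ℚ X).ext fun w => by rw [basisFreeMonoid_apply, h]

/-- `wordCoeff w` as a linear map. -/
def wordCoeffLinear (w : List X) : FreeAlgebra ℚ X →ₗ[ℚ] ℚ :=
  (FreeAlgebra.basisFreeMonoid ℚ X).coord (FreeMonoid.ofList w)

theorem wordCoeffLinear_apply (w : List X) (p : FreeAlgebra ℚ X) :
    wordCoeffLinear w p = wordCoeff w p := rfl

theorem wordCoeff_monomialWord [DecidableEq X] (w v : List X) :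
    wordCoeff w (monomialWord v) = if v = w then 1 else 0 := by
  have h : monomialWord v = FreeAlgebra.basisFreeMonoid ℚ X (FreeMonoid.ofList v) := by
    rw [basisFreeMonoid_apply, FreeMonoid.toList_ofList]
  rw [wordCoeff, h, Module.Basis.repr_self]
  by_cases hvw : v = w
  · rw [hvw, Finsupp.single_eq_same, if_pos rfl]
  · rw [Finsupp.single_eq_of_ne' (FreeMonoid.ofList.injective.ne hvw), if_neg hvw]

theorem wordCoeff_add (w : List X) (p q : FreeAlgebra ℚ X) :
    wordCoeff w (p + q) = wordCoeff w p + wordCoeff w q := map_add (wordCoeffLinear w) p q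

theorem wordCoeff_sub (w : List X) (p q : FreeAlgebra ℚ X) :
    wordCoeff w (p - q) = wordCoeff w p - wordCoeff w q := map_sub (wordCoeffLinear w) p q

theorem wordCoeff_two_mul (w : List X) (p : FreeAlgebra ℚ X) :
    wordCoeff w (2 * p) = 2 * wordCoeff w p := by rw [two_mul, two_mul, wordCoeff_add]

theorem wordCoeff_nil_one : wordCoeff [] (1 : FreeAlgebra ℚ X) = 1 := by
  classical
  rw [← monomialWord_nil, wordCoeff_monomialWord, if_pos rfl]

theorem wordCoeff_cons_ι_mul (x : X) (w : List X) (p : FreeAlgebra ℚ X) :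
    wordCoeff (x :: w) (FreeAlgebra.ι ℚ x * p) = wordCoeff w p := by
  classical
  have h : wordCoeffLinear (x :: w) ∘ₗ LinearMap.mulLeft ℚ (FreeAlgebra.ι ℚ x) =
      wordCoeffLinear w := by
    refine linearMap_ext_monomialWord fun v => ?_
    simp only [LinearMap.comp_apply, LinearMap.mulLeft_apply, wordCoeffLinear_apply]
    rw [← monomialWord_cons, wordCoeff_monomialWord, wordCoeff_monomialWord]
    simp
  exact LinearMap.congr_fun h p

theorem wordCoeff_cons_ι_mul_of_ne {x y : X} (hxy : y ≠ x) (w : List X) (p : FreeAlgebra ℚ X) :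
    wordCoeff (x :: w) (FreeAlgebra.ι ℚ y * p) = 0 := by
  classical
  have h : wordCoeffLinear (x :: w) ∘ₗ LinearMap.mulLeft ℚ (FreeAlgebra.ι ℚ y) = 0 := by
    refine linearMap_ext_monomialWord fun v => ?_
    simp only [LinearMap.comp_apply, LinearMap.mulLeft_apply, wordCoeffLinear_apply]
    rw [← monomialWord_cons, wordCoeff_monomialWord]
    simp [hxy]
  exact LinearMap.congr_fun h p

end FreeAlgebra

/-! ### `ce`-polynomials -/

namespace CEPoly

/-- The variable `c`. -/
abbrev c : CEPoly := FreeAlgebra.ι ℚ CELetter.c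

/-- The variable `e`. -/
abbrev e : CEPoly := FreeAlgebra.ι ℚ CELetter.e

/-- The `ce`-polynomial form of `ABPoly.lucas`. -/
def lucas : ℕ → CEPoly
  | 0 => 1
  | 1 => 2 * c
  | n + 2 => 2 * (c * lucas (n + 1)) - e * (e * lucas n)

theorem ceToAB_lucas (n : ℕ) : ceToAB (lucas n) = ABPoly.lucas n := by
  have hc : ceToAB c = ABPoly.c := by simp [ceToAB, c]
  have he : ceToAB e = ABPoly.e := by simp [ceToAB, e]
  induction n using Nat.twoStepInduction with
  | zero => simp [lucas, ABPoly.lucas]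
  | one => rw [lucas, ABPoly.lucas, map_mul, hc, map_ofNat]
  | more n ih1 ih2 =>
    simp only [lucas, ABPoly.lucas, map_sub, map_mul, map_ofNat, hc, he, ih1, ih2, pow_two,
      mul_assoc]

/-- In the recurrence, only the term 2c V_n of V_{n+1} has words that start with c. -/
theorem wordCoeff_c_cons (w : List CELetter) (n : ℕ) :
    wordCoeff (CELetter.c :: w) (lucas (n + 1)) = 2 * wordCoeff w (lucas n) := by
  cases n with
  | zero =>
    simp only [lucas]
    rw [wordCoeff_two_mul, ← mul_one c, wordCoeff_cons_ι_mul]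
  | succ n =>
    rw [lucas, wordCoeff_sub, wordCoeff_two_mul, wordCoeff_cons_ι_mul,
      wordCoeff_cons_ι_mul_of_ne (by simp), sub_zero]

theorem wordCoeff_e_cons_e_cons (w : List CELetter) (n : ℕ) :
    wordCoeff (CELetter.e :: CELetter.e :: w) (lucas (n + 2)) = -wordCoeff w (lucas n) := by
  rw [lucas, wordCoeff_sub, wordCoeff_two_mul, wordCoeff_cons_ι_mul_of_ne (by simp),
    wordCoeff_cons_ι_mul, wordCoeff_cons_ι_mul, mul_zero, zero_sub]

theorem wordCoeff_replicate_append (k : ℕ) (w : List CELetter) (n : ℕ) :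
    wordCoeff (List.replicate k CELetter.c ++ w) (lucas (k + n)) =
      2 ^ k * wordCoeff w (lucas n) := by
  induction k with
  | zero => simp
  | succ k ih =>
    rw [List.replicate_succ, List.cons_append, Nat.succ_add, wordCoeff_c_cons, ih, pow_succ']
    ring

theorem wordCoeff_ceWord {r n : ℕ} (k : Fin (r + 1) → ℕ) (h : 2 * r + ∑ i, k i = n) :
    wordCoeff (ceWord k) (lucas n) = (-1) ^ r * 2 ^ ∑ i, k i := by
  induction r generalizing n with
  | zero =>
    have h' : n = k 0 + 0 := by simpa using h.symm
    have := wordCoeff_replicate_append (k 0) [] 0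
    rw [lucas, wordCoeff_nil_one] at this
    simpa [ceWord, h', List.intercalate] using this
  | succ r ih =>
    rw [Fin.sum_univ_succ] at h ⊢
    obtain rfl : n = k 0 + (2 * r + ∑ i, k (Fin.succ i) + 2) := by omega
    have hw : ceWord k = List.replicate (k 0) CELetter.c ++
        CELetter.e :: CELetter.e :: ceWord fun i => k (Fin.succ i) := by
      rw [ceWord, List.ofFn_succ, List.intercalate_cons_of_ne_nil (by simp)]
      simp [ceWord]
    rw [hw, wordCoeff_replicate_append, wordCoeff_e_cons_e_cons, ih _ rfl, pow_add, pow_succ]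
    ring

/-- The inverse of the substitution `ceToAB`. -/
def ofAB : ABPoly →ₐ[ℚ] CEPoly :=
  FreeAlgebra.lift ℚ fun
    | ABLetter.a => (2⁻¹ : ℚ) • (c + e)
    | ABLetter.b => (2⁻¹ : ℚ) • (c - e)

theorem ofAB_comp_ceToAB : ofAB.comp ceToAB = AlgHom.id ℚ CEPoly := by
  refine FreeAlgebra.hom_ext (funext fun x => ?_)
  cases x
  · simp only [Function.comp_apply, AlgHom.comp_apply, ceToAB, ofAB, FreeAlgebra.lift_ι_apply,
      ABPoly.c, ABPoly.a, ABPoly.b, map_add, AlgHom.id_apply]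
    module
  · simp only [Function.comp_apply, AlgHom.comp_apply, ceToAB, ofAB, FreeAlgebra.lift_ι_apply,
      ABPoly.e, ABPoly.a, ABPoly.b, map_sub, AlgHom.id_apply]
    module

theorem ceToAB_injective : Function.Injective ceToAB := fun p q h => by
  have := congrArg ofAB h
  rwa [← AlgHom.comp_apply, ← AlgHom.comp_apply, ofAB_comp_ceToAB] at this

end CEPoly

/-! ### `cd`-polynomials -/

namespace CDPoly

/-- The variable `c`. -/
abbrev c : CDPoly := FreeAlgebra.ι ℚ CDLetter.c

/-- The variable `d`. -/
abbrev d : CDPoly := FreeAlgebra.ι ℚ CDLetter.d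

/-- The `cd`-polynomial form of `ABPoly.lucas`. -/
def lucas : ℕ → CDPoly
  | 0 => 1
  | 1 => 2 * c
  | n + 2 => 2 * (c * lucas (n + 1)) - c * (c * lucas n) + 2 * (d * lucas n)

theorem cdToAB_lucas (n : ℕ) : cdToAB (lucas n) = ABPoly.lucas n := by
  have hc : cdToAB c = ABPoly.c := by simp [cdToAB, c]
  have hd : cdToAB d = ABPoly.d := by simp [cdToAB, d]
  have he : ABPoly.e ^ 2 = ABPoly.c * ABPoly.c - 2 * ABPoly.d := by
    simp only [ABPoly.e, ABPoly.c, ABPoly.d]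
    noncomm_ring
  induction n using Nat.twoStepInduction with
  | zero => simp [lucas, ABPoly.lucas]
  | one => rw [lucas, ABPoly.lucas, map_mul, hc, map_ofNat]
  | more n ih1 ih2 =>
    simp only [lucas, ABPoly.lucas, map_add, map_sub, map_mul, map_ofNat, hc, hd, he, ih1, ih2]
    noncomm_ring

theorem wordCoeff_d_cons (w : List CDLetter) (n : ℕ) :
    wordCoeff (CDLetter.d :: w) (lucas (n + 2)) = 2 * wordCoeff w (lucas n) := by
  simp only [lucas, wordCoeff_add, wordCoeff_sub, wordCoeff_two_mul, wordCoeff_cons_ι_mul]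
  rw [wordCoeff_cons_ι_mul_of_ne (by simp), wordCoeff_cons_ι_mul_of_ne (by simp)]
  ring

theorem wordCoeff_c_cons_d_cons (w : List CDLetter) (n : ℕ) :
    wordCoeff (CDLetter.c :: CDLetter.d :: w) (lucas (n + 3)) =
      2 * wordCoeff (CDLetter.d :: w) (lucas (n + 2)) := by
  rw [lucas]
  simp only [wordCoeff_add, wordCoeff_sub, wordCoeff_two_mul, wordCoeff_cons_ι_mul]
  rw [wordCoeff_cons_ι_mul_of_ne (by simp), wordCoeff_cons_ι_mul_of_ne (by simp)]
  ring

theorem wordCoeff_c_cons_c_cons (w : List CDLetter) (n : ℕ) :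
    wordCoeff (CDLetter.c :: CDLetter.c :: w) (lucas (n + 2)) =
      2 * wordCoeff (CDLetter.c :: w) (lucas (n + 1)) - wordCoeff w (lucas n) := by
  rw [lucas]
  simp only [wordCoeff_add, wordCoeff_sub, wordCoeff_two_mul, wordCoeff_cons_ι_mul]
  rw [wordCoeff_cons_ι_mul_of_ne (by simp)]
  ring

/-- These coefficients satisfy x_{k+2} = 2x_{k+1} - x_k with initial values 1 and 2. -/
theorem wordCoeff_replicate (k : ℕ) :
    wordCoeff (List.replicate k CDLetter.c) (lucas k) = (k : ℚ) + 1 := by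
  induction k using Nat.twoStepInduction with
  | zero => simp [lucas, wordCoeff_nil_one]
  | one =>
    rw [lucas, wordCoeff_two_mul, ← mul_one c, List.replicate_one, wordCoeff_cons_ι_mul,
      wordCoeff_nil_one]
    norm_num
  | more k ih1 ih2 =>
    rw [List.replicate_succ, List.replicate_succ, wordCoeff_c_cons_c_cons, ← List.replicate_succ,
      ih1, ih2]
    push_cast
    ring

/-- The same linear recurrence in `k`, with initial values X and 2X, where X = `2 * wordCoeff w
(lucas n)` comes from the leading d. -/
theorem wordCoeff_replicate_append (k : ℕ) (w : List CDLetter) (n : ℕ) :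
    wordCoeff (List.replicate k CDLetter.c ++ CDLetter.d :: w) (lucas (k + (n + 2))) =
      ((k : ℚ) + 1) * (2 * wordCoeff w (lucas n)) := by
  induction k using Nat.twoStepInduction with
  | zero => simp [wordCoeff_d_cons]
  | one =>
    rw [List.replicate_one, List.singleton_append, show 1 + (n + 2) = n + 3 by ring,
      wordCoeff_c_cons_d_cons, wordCoeff_d_cons]
    norm_num
  | more k ih1 ih2 =>
    rw [List.replicate_succ, List.replicate_succ, List.cons_append, List.cons_append,
      show k + 2 + (n + 2) = k + (n + 2) + 2 by ring, wordCoeff_c_cons_c_cons, ← List.cons_append,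
      ← List.replicate_succ, ih1, show k + (n + 2) + 1 = k + 1 + (n + 2) by ring, ih2]
    push_cast
    ring

theorem wordCoeff_cdWord {r n : ℕ} (k : Fin (r + 1) → ℕ) (h : 2 * r + ∑ i, k i = n) :
    wordCoeff (cdWord k) (lucas n) = 2 ^ r * ∏ i, ((k i : ℚ) + 1) := by
  induction r generalizing n with
  | zero =>
    obtain rfl : k 0 = n := by simpa using h
    simpa [cdWord, List.intercalate] using wordCoeff_replicate (k 0)
  | succ r ih =>
    rw [Fin.sum_univ_succ] at h
    obtain rfl : n = k 0 + (2 * r + ∑ i, k (Fin.succ i) + 2) := by omega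
    have hw : cdWord k = List.replicate (k 0) CDLetter.c ++
        CDLetter.d :: cdWord fun i => k (Fin.succ i) := by
      rw [cdWord, List.ofFn_succ, List.intercalate_cons_of_ne_nil (by simp)]
      simp [cdWord]
    rw [hw, wordCoeff_replicate_append, ih _ rfl,
      Fin.prod_univ_succ fun i => (k i : ℚ) + 1]
    ring

/-! ### Injectivity of the cd-substitution -/

/-- The substitution `d ↦ (c² - d)/2`; it turns `cdToAB` into the substitution `d ↦ e²`. -/
def twist : CDPoly →ₐ[ℚ] CDPoly :=
  FreeAlgebra.lift ℚ fun
    | CDLetter.c => c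
    | CDLetter.d => (2⁻¹ : ℚ) • (c * c - d)

/-- The substitution `d ↦ e²`. -/
def toCE : CDPoly →ₐ[ℚ] CEPoly :=
  FreeAlgebra.lift ℚ fun
    | CDLetter.c => CEPoly.c
    | CDLetter.d => CEPoly.e * CEPoly.e

/-- The substitution `d ↦ c² - 2d`, inverse to `twist`. -/
def untwist : CDPoly →ₐ[ℚ] CDPoly :=
  FreeAlgebra.lift ℚ fun
    | CDLetter.c => c
    | CDLetter.d => c * c - (2 : ℚ) • d

theorem untwist_comp_twist : untwist.comp twist = AlgHom.id ℚ CDPoly := by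
  refine FreeAlgebra.hom_ext (funext fun x => ?_)
  cases x
  · simp [untwist, twist]
  · simp only [Function.comp_apply, AlgHom.comp_apply, untwist, twist, FreeAlgebra.lift_ι_apply,
      map_sub, map_smul, map_mul, AlgHom.id_apply]
    module

theorem ceToAB_comp_toCE_comp_twist : (ceToAB.comp toCE).comp twist = cdToAB := by
  refine FreeAlgebra.hom_ext (funext fun x => ?_)
  cases x
  · simp [ceToAB, twist, toCE, cdToAB]
  · simp only [Function.comp_apply, AlgHom.comp_apply, ceToAB, twist, toCE, cdToAB,
      FreeAlgebra.lift_ι_apply, map_sub, map_smul, map_mul, ABPoly.c, ABPoly.d, ABPoly.e,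
      add_mul, mul_add, sub_mul, mul_sub]
    module

/-- The `cd`-monomial whose image under `toCE` is the given `ce`-word, and `0` if there is none. -/
def ofCEWord : List CELetter → CDPoly
  | [] => 1
  | CELetter.c :: w => c * ofCEWord w
  | CELetter.e :: CELetter.e :: w => d * ofCEWord w
  | _ => 0

/-- The `ce`-word obtained from a `cd`-word by substituting `e²` for `d`. -/
def toCEWord : List CDLetter → List CELetter
  | [] => []
  | CDLetter.c :: w => CELetter.c :: toCEWord w
  | CDLetter.d :: w => CELetter.e :: CELetter.e :: toCEWord w

theorem toCE_monomialWord (w : List CDLetter) :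
    toCE (monomialWord w) = monomialWord (toCEWord w) := by
  induction w with
  | nil => simp [toCEWord]
  | cons x w ih => cases x <;> simp [toCEWord, ih] <;> simp [toCE, mul_assoc]

theorem ofCEWord_toCEWord (w : List CDLetter) : ofCEWord (toCEWord w) = monomialWord w := by
  induction w with
  | nil => simp [toCEWord, ofCEWord]
  | cons x w ih => cases x <;> simp [toCEWord, ofCEWord, ih]

/-- The words c and e² form a prefix code, so distinct cd-words have distinct images and `ofCEWord`
decodes them; its linear extension is a left inverse. -/
theorem toCE_injective : Function.Injective toCE := by
  let L : CEPoly →ₗ[ℚ] CDPoly :=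
    (FreeAlgebra.basisFreeMonoid ℚ CELetter).constr ℚ fun w => ofCEWord w.toList
  have hL (w : List CELetter) : L (monomialWord w) = ofCEWord w := by
    have h := (FreeAlgebra.basisFreeMonoid ℚ CELetter).constr_basis ℚ
      (fun w => ofCEWord w.toList) (FreeMonoid.ofList w)
    rwa [basisFreeMonoid_apply, FreeMonoid.toList_ofList] at h
  have h : L ∘ₗ toCE.toLinearMap = LinearMap.id := linearMap_ext_monomialWord fun w => by
    rw [LinearMap.comp_apply, AlgHom.toLinearMap_apply, toCE_monomialWord, hL, ofCEWord_toCEWord,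
      LinearMap.id_apply]
  exact Function.LeftInverse.injective (g := L) fun p => LinearMap.congr_fun h p

/-- Since d = (c² - e²)/2 in ℚ⟨a, b⟩, the substitution factors as `twist`, then d ↦ e², then
`ceToAB`, each of them injective. -/
theorem cdToAB_injective : Function.Injective cdToAB := by
  have h : Function.Injective twist := fun p q h => by
    have := congrArg untwist h
    rwa [← AlgHom.comp_apply, ← AlgHom.comp_apply, untwist_comp_twist] at this
  rw [← ceToAB_comp_toCE_comp_twist]
  exact (CEPoly.ceToAB_injective.comp toCE_injective).comp h

end CDPoly

/-! ### The `ab`-index as a sum over chains -/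

/-- The product `u₁ ⋯ u_m` with `u_i = t` for `i ∈ S` and `u_i = s` for `i ∉ S`. -/
def rankMonomial (s t : ABPoly) (m : ℕ) (S : Finset ℕ) : ABPoly :=
  ((List.range m).map fun i => if i + 1 ∈ S then t else s).prod

theorem rankMonomial_empty (s t : ABPoly) (m : ℕ) : rankMonomial s t m ∅ = s ^ m := by
  simp [rankMonomial]

/-- As `k` exceeds every element of `S`, all positions after it carry `s`, and those before it are
governed by `S` alone. -/
theorem rankMonomial_insert (s t : ABPoly) {m k : ℕ} {S : Finset ℕ} (hk : 1 ≤ k) (hkm : k ≤ m)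
    (hS : ∀ i ∈ S, i < k) :
    rankMonomial s t m (insert k S) = rankMonomial s t (k - 1) S * t * s ^ (m - k) := by
  obtain ⟨k, rfl⟩ : ∃ j, k = j + 1 := ⟨k - 1, by omega⟩
  obtain ⟨l, rfl⟩ : ∃ l, m = k + 1 + l := ⟨m - (k + 1), by omega⟩
  have h1 : ((List.range k).map fun i => if i + 1 ∈ insert (k + 1) S then t else s) =
      (List.range k).map fun i => if i + 1 ∈ S then t else s := by
    refine List.map_congr_left fun i hi => ?_
    rw [List.mem_range] at hi
    simp only [Finset.mem_insert, show i + 1 ≠ k + 1 by omega, false_or]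
  have h2 : ((List.range l).map fun i => if k + 1 + i + 1 ∈ insert (k + 1) S then t else s) =
      (List.range l).map fun _ => s := by
    refine List.map_congr_left fun i _ => if_neg fun h => ?_
    rcases Finset.mem_insert.1 h with h | h
    · omega
    · have := hS _ h
      omega
  rw [rankMonomial, List.range_add, List.range_succ]
  simp only [List.map_append, List.map_map, List.prod_append, List.map_singleton,
    List.prod_singleton, Function.comp_def]
  rw [h1, h2]
  simp [rankMonomial]

section Chains

open Classical

variable {P : Type*} [PartialOrder P] [Fintype P]

/-- The chains strictly below `w` that consist of elements of positive rank. -/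
def chainsBelow (r : P → ℕ) (w : P) : Finset (Finset P) :=
  Finset.univ.filter fun C => IsChain (· ≤ ·) (C : Set P) ∧ ∀ v ∈ C, 1 ≤ r v ∧ v < w

theorem mem_chainsBelow {r : P → ℕ} {w : P} {C : Finset P} :
    C ∈ chainsBelow r w ↔ IsChain (· ≤ ·) (C : Set P) ∧ ∀ v ∈ C, 1 ≤ r v ∧ v < w := by
  simp [chainsBelow]

/-- The `ab`-index of the interval below `w`, as a sum over chains. -/
def chainSum (r : P → ℕ) (s t : ABPoly) (w : P) : ABPoly :=
  ∑ C ∈ chainsBelow r w, rankMonomial s t (r w - 1) (C.image r)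

/-- A nonempty chain is its maximum `v` together with a chain strictly below `v`. -/
theorem chainsBelow_eq (r : P → ℕ) (w : P) :
    chainsBelow r w = insert ∅ ((Finset.univ.filter fun v => 1 ≤ r v ∧ v < w).biUnion
      fun v => (chainsBelow r v).image (insert v)) := by
  ext C
  simp only [Finset.mem_insert, Finset.mem_biUnion, Finset.mem_filter, Finset.mem_univ, true_and,
    Finset.mem_image]
  constructor
  · intro hC
    rw [mem_chainsBelow] at hC
    rcases C.eq_empty_or_nonempty with h | h
    · exact Or.inl h
    right
    obtain ⟨v, hv⟩ := C.exists_maximal h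
    refine ⟨v, hC.2 v hv.1, C.erase v, ?_, Finset.insert_erase hv.1⟩
    rw [mem_chainsBelow]
    refine ⟨hC.1.mono (by simp), fun u hu => ?_⟩
    obtain ⟨huv, hu⟩ := Finset.mem_erase.1 hu
    refine ⟨(hC.2 u hu).1, lt_of_le_of_ne ?_ huv⟩
    rcases hC.1.total hu hv.1 with h | h
    · exact h
    · exact hv.2 hu h
  · rintro (rfl | ⟨v, hv, D, hD, rfl⟩)
    · simp [mem_chainsBelow]
    · rw [mem_chainsBelow] at hD ⊢
      refine ⟨?_, fun u hu => ?_⟩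
      · rw [Finset.coe_insert]
        exact hD.1.insert fun u hu _ => Or.inr (hD.2 u hu).2.le
      · rcases Finset.mem_insert.1 hu with rfl | hu
        · exact hv
        · exact ⟨(hD.2 u hu).1, (hD.2 u hu).2.trans hv.2⟩

/-- Removing the maximum of a chain. -/
theorem chainSum_eq {r : P → ℕ} (hr : StrictMono r) (s t : ABPoly) (w : P) :
    chainSum r s t w = s ^ (r w - 1) +
      ∑ v ∈ Finset.univ.filter (fun v => 1 ≤ r v ∧ v < w),
        chainSum r s t v * t * s ^ (r w - 1 - r v) := by
  have hnot {v : P} {D : Finset P} (hD : D ∈ chainsBelow r v) : v ∉ D := fun h =>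
    ((mem_chainsBelow.1 hD).2 v h).2.false
  rw [chainSum, chainsBelow_eq, Finset.sum_insert, Finset.image_empty, rankMonomial_empty,
    Finset.sum_biUnion]
  · congr 1
    refine Finset.sum_congr rfl fun v hv => ?_
    obtain ⟨hv1, hvw⟩ := (Finset.mem_filter.1 hv).2
    rw [Finset.sum_image, chainSum, Finset.sum_mul, Finset.sum_mul]
    · refine Finset.sum_congr rfl fun D hD => ?_
      rw [Finset.image_insert, rankMonomial_insert s t hv1 (Nat.le_sub_one_of_lt (hr hvw))]
      intro i hi
      obtain ⟨u, hu, rfl⟩ := Finset.mem_image.1 hi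
      exact hr ((mem_chainsBelow.1 hD).2 u hu).2
    · intro D hD D' hD' h
      rw [← Finset.erase_insert (hnot hD), ← Finset.erase_insert (hnot hD'), h]
  -- The union is disjoint because a chain determines its maximum.
  · intro v _ v' _ hne
    refine Finset.disjoint_left.2 fun C hC hC' => hne ?_
    obtain ⟨D, hD, rfl⟩ := Finset.mem_image.1 hC
    obtain ⟨D', hD', h⟩ := Finset.mem_image.1 hC'
    have h1 : v ∈ insert v' D' := h ▸ Finset.mem_insert_self v D
    have h2 : v' ∈ insert v D := h ▸ Finset.mem_insert_self v' D'
    rcases Finset.mem_insert.1 h1 with h1 | h1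
    · exact h1
    rcases Finset.mem_insert.1 h2 with h2 | h2
    · exact h2.symm
    · exact absurd ((mem_chainsBelow.1 hD').2 v h1).2 ((mem_chainsBelow.1 hD).2 v' h2).2.asymm
  · simp

theorem flagF_eq_card (S : Finset ℕ) :
    flagF P S = (Finset.univ.filter fun C : Finset P =>
      IsChain (· ≤ ·) (C : Set P) ∧ C.image posetRank = S).card := by
  rw [flagF, Nat.card_eq_fintype_card, Fintype.card_subtype]

/-- Group the chains by rank set: the fibre over `S` has `f_S` members. Rank sets inside {1, …, m},
for a poset of rank m + 1, exclude precisely the chains that contain the top or an element of rank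
0. -/
theorem upsilon_eq_chainSum [OrderTop P] (hr : StrictMono (posetRank : P → ℕ)) (s t : ABPoly) :
    upsilon P s t = chainSum posetRank s t (⊤ : P) := by
  have hmaps : ∀ C ∈ chainsBelow (posetRank : P → ℕ) (⊤ : P),
      C.image posetRank ∈ (Finset.Icc 1 (posetRank (⊤ : P) - 1)).powerset := by
    intro C hC
    rw [Finset.mem_powerset]
    intro i hi
    obtain ⟨u, hu, rfl⟩ := Finset.mem_image.1 hi
    have := (mem_chainsBelow.1 hC).2 u hu
    exact Finset.mem_Icc.2 ⟨this.1, Nat.le_sub_one_of_lt (hr this.2)⟩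
  rw [chainSum, ← Finset.sum_fiberwise_of_maps_to hmaps, upsilon]
  refine Finset.sum_congr rfl fun S hS => ?_
  have hfilter : (chainsBelow (posetRank : P → ℕ) ⊤).filter (fun C => C.image posetRank = S) =
      Finset.univ.filter fun C : Finset P =>
        IsChain (· ≤ ·) (C : Set P) ∧ C.image posetRank = S := by
    ext C
    simp only [Finset.mem_filter, mem_chainsBelow, Finset.mem_univ, true_and]
    refine ⟨fun h => ⟨h.1.1, h.2⟩, fun h => ⟨⟨h.1, fun v hv => ?_⟩, h.2⟩⟩
    have hvS : posetRank v ∈ S := h.2 ▸ Finset.mem_image_of_mem _ hv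
    have := Finset.mem_Icc.1 (Finset.mem_powerset.1 hS hvS)
    refine ⟨this.1, lt_top_iff_ne_top.2 ?_⟩
    rintro rfl
    omega
  rw [flagF_eq_card, ← hfilter, Nat.cast_smul_eq_nsmul, ← Finset.sum_const]
  refine Finset.sum_congr rfl fun C hC => ?_
  rw [(Finset.mem_filter.1 hC).2, rankMonomial]

end Chains

/-- A strictly monotone function whose values can be lowered by one step at a time is the rank. -/
theorem posetRank_eq_of_strictMono {P : Type*} [PartialOrder P] {f : P → ℕ} (hf : StrictMono f)
    (h : ∀ v, f v ≠ 0 → ∃ u < v, f u + 1 = f v) : posetRank = f := by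
  have hle (k : ℕ) : ∀ v, f v = k → (k : ℕ∞) ≤ Order.height v := by
    induction k with
    | zero => simp
    | succ k ih =>
      intro v hv
      obtain ⟨u, huv, hu⟩ := h v (by omega)
      calc ((k + 1 : ℕ) : ℕ∞) = (k : ℕ∞) + 1 := by push_cast; rfl
        _ ≤ Order.height u + 1 := by gcongr; exact ih u (by omega)
        _ ≤ Order.height v := Order.height_add_one_le huv
  funext v
  have h1 : Order.height v ≤ f v := by
    simpa using Order.height_le_height_apply_of_strictMono f hf v
  rw [posetRank, le_antisymm h1 (hle _ v rfl), ENat.toNat_natCast]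

/-! ### The ladder -/

namespace Ladder

variable {n : ℕ}

/-- The rank of an element of the ladder. -/
def rk (x : Ladder n) : ℕ := x.val.natAbs

theorem lt_iff {x y : Ladder n} : x < y ↔ x.rk < y.rk := by
  have habs : |x.val| < |y.val| ↔ x.rk < y.rk := by
    rw [rk, rk, Int.abs_eq_natAbs, Int.abs_eq_natAbs, Nat.cast_lt]
  rw [lt_iff_le_and_ne, ← habs]
  constructor
  · rintro ⟨h | h, hne⟩
    · exact absurd h hne
    · exact h
  · intro h
    exact ⟨Or.inr h, by rintro rfl; exact h.false⟩

theorem rk_le_of_le {x y : Ladder n} (h : x ≤ y) : x.rk ≤ y.rk := by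
  rcases h.eq_or_lt with rfl | h
  · exact le_rfl
  · exact (lt_iff.1 h).le

theorem eq_of_le_of_rk_eq {x y : Ladder n} (h : x ≤ y) (hrk : x.rk = y.rk) : x = y := by
  rcases h.eq_or_lt with rfl | h
  · rfl
  · exact absurd hrk (lt_iff.1 h).ne

theorem ext_val {x y : Ladder n} (h : x.val = y.val) : x = y := Subtype.ext h

theorem rk_bot : (⊥ : Ladder n).rk = 0 := rfl

theorem rk_top : (⊤ : Ladder n).rk = n + 1 := by
  change ((n : ℤ) + 1).natAbs = n + 1
  omega

theorem rk_le (x : Ladder n) : x.rk ≤ n + 1 := rk_top (n := n) ▸ rk_le_of_le le_top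

theorem exists_rk_eq (k : ℕ) (hk : k ≤ n + 1) : ∃ x : Ladder n, x.rk = k :=
  ⟨⟨(k : ℤ), by constructor <;> omega⟩, by simp [rk, val]⟩

theorem exists_succ_le {x y : Ladder n} (h : x < y) : ∃ z, x < z ∧ z ≤ y ∧ z.rk = x.rk + 1 := by
  have hxy := lt_iff.1 h
  rcases (Nat.succ_le_of_lt hxy).eq_or_lt with h' | h'
  · exact ⟨y, h, le_rfl, h'.symm⟩
  · obtain ⟨z, hz⟩ := exists_rk_eq (n := n) (x.rk + 1) (by have := y.rk_le; omega)
    exact ⟨z, lt_iff.2 (by omega), (lt_iff.2 (by omega)).le, hz⟩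

theorem exists_le_pred {x y : Ladder n} (h : x < y) : ∃ z, x ≤ z ∧ z < y ∧ z.rk + 1 = y.rk := by
  have hxy := lt_iff.1 h
  rcases (Nat.succ_le_of_lt hxy).eq_or_lt with h' | h'
  · exact ⟨x, le_rfl, h, h'⟩
  · obtain ⟨z, hz⟩ := exists_rk_eq (n := n) (y.rk - 1) (by have := y.rk_le; omega)
    exact ⟨z, (lt_iff.2 (by omega)).le, lt_iff.2 (by omega), by omega⟩

open Classical in
theorem card_filter_rk_eq {k : ℕ} (h0 : 0 < k) (hn : k ≤ n) :
    (Finset.univ.filter fun y : Ladder n => y.rk = k).card = 2 := by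
  let p : Ladder n := ⟨(k : ℤ), by constructor <;> omega⟩
  let m : Ladder n := ⟨-(k : ℤ), by constructor <;> omega⟩
  have hp : p.val = k := rfl
  have hm : m.val = -k := rfl
  have h : (Finset.univ.filter fun y : Ladder n => y.rk = k) = {p, m} := by
    ext y
    simp only [Finset.mem_filter, Finset.mem_univ, true_and, Finset.mem_insert,
      Finset.mem_singleton]
    constructor
    · intro hy
      rcases le_total 0 y.val with h | h
      · exact Or.inl (ext_val (by rw [hp, ← hy, rk]; omega))
      · exact Or.inr (ext_val (by rw [hm, ← hy, rk]; omega))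
    · rintro (rfl | rfl)
      · rw [rk, hp]; omega
      · rw [rk, hm]; omega
  rw [h, Finset.card_pair]
  intro h
  have := congrArg val h
  omega

open Classical in
/-- Between two elements of the ladder there are two elements of each intermediate rank. -/
theorem sum_between {A : Type*} [AddCommMonoid A] (f : ℕ → A) {x y : Ladder n} (h : x < y) :
    ∑ z ∈ Finset.univ.filter (fun z => x ≤ z ∧ z ≤ y), f z.rk =
      f x.rk + f y.rk + 2 • ∑ k ∈ Finset.Ioo x.rk y.rk, f k := by
  have hsplit : (Finset.univ.filter fun z => x ≤ z ∧ z ≤ y) =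
      insert x (insert y (Finset.univ.filter fun z : Ladder n => z.rk ∈ Finset.Ioo x.rk y.rk)) := by
    ext z
    simp only [Finset.mem_filter, Finset.mem_univ, true_and, Finset.mem_insert, Finset.mem_Ioo,
      ← lt_iff]
    constructor
    · rintro ⟨h1, h2⟩
      rcases h1.eq_or_lt with rfl | h1
      · exact Or.inl rfl
      rcases h2.eq_or_lt with rfl | h2
      · exact Or.inr (Or.inl rfl)
      exact Or.inr (Or.inr ⟨h1, h2⟩)
    · rintro (rfl | rfl | h')
      · exact ⟨le_rfl, h.le⟩
      · exact ⟨h.le, le_rfl⟩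
      · exact ⟨h'.1.le, h'.2.le⟩
  have hmid : ∑ z ∈ Finset.univ.filter (fun z : Ladder n => z.rk ∈ Finset.Ioo x.rk y.rk), f z.rk =
      2 • ∑ k ∈ Finset.Ioo x.rk y.rk, f k := by
    rw [← Finset.sum_fiberwise_of_maps_to (g := rk) (t := Finset.Ioo x.rk y.rk)
      (fun z hz => (Finset.mem_filter.1 hz).2), Finset.smul_sum]
    refine Finset.sum_congr rfl fun k hk => ?_
    rw [Finset.filter_filter]
    have hk' := Finset.mem_Ioo.1 hk
    have : (Finset.univ.filter fun z : Ladder n => z.rk ∈ Finset.Ioo x.rk y.rk ∧ z.rk = k) =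
        Finset.univ.filter fun z : Ladder n => z.rk = k :=
      Finset.filter_congr fun z _ => ⟨fun h => h.2, fun h => ⟨h ▸ hk, h⟩⟩
    rw [this, ← card_filter_rk_eq (n := n) (k := k) (by omega) (by have := y.rk_le; omega),
      ← Finset.sum_const]
    exact Finset.sum_congr rfl fun z hz => by rw [(Finset.mem_filter.1 hz).2]
  rw [hsplit, Finset.sum_insert, Finset.sum_insert, hmid, add_assoc]
  · simp
  · simp [h.ne]

end Ladder

namespace ABPoly

/-! ### The lattice-path recursion -/

/-- The solution of the recursion `U(i, j) = U(i-1, j) c + U(i, j-1) c - U(i-1, j-1) e²` with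
`U(0, 0) = 1`. -/
def grid : ℕ → ℕ → ABPoly
  | 0, 0 => 1
  | i + 1, 0 => grid i 0 * c
  | 0, j + 1 => grid 0 j * c
  | i + 1, j + 1 => grid i (j + 1) * c + grid (i + 1) j * c - grid i j * e ^ 2

/-- `U(i-1, j) + U(i, j-1)`, where `U` vanishes at negative arguments. -/
def gridStep : ℕ → ℕ → ABPoly
  | 0, 0 => 0
  | i + 1, 0 => grid i 0
  | 0, j + 1 => grid 0 j
  | i + 1, j + 1 => grid i (j + 1) + grid (i + 1) j

/-- The increments of `grid`. -/
def gridIncr (i j : ℕ) : ABPoly := if i = 0 ∧ j = 0 then 1 else 2 * (gridStep i j * b)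

theorem c_eq : c = e + 2 * b := by simp only [c, e]; noncomm_ring

theorem row_sum_zero (j : ℕ) :
    ∑ q ∈ Finset.range (j + 1), gridIncr 0 q * e ^ (j - q) = grid 0 j := by
  induction j with
  | zero => simp [gridIncr, grid]
  | succ j ih =>
    rw [Finset.sum_range_succ, grid, ← ih, c_eq, mul_add, Finset.sum_mul]
    congr 1
    · refine Finset.sum_congr rfl fun q hq => ?_
      rw [Finset.mem_range] at hq
      rw [mul_assoc, ← pow_succ, show j + 1 - q = j - q + 1 by omega]
    · rw [ih]
      simp only [gridIncr, gridStep, Nat.sub_self]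
      rw [if_neg (by omega)]
      noncomm_ring

/-- The new row in the double sum of `grid_eq_sum`. By c = e + 2b, the recursion of `grid` says that
this difference, on passing from `j` to `j + 1`, is multiplied by e and gains the increment. -/
theorem row_sum_succ (i j : ℕ) :
    ∑ q ∈ Finset.range (j + 1), gridIncr (i + 1) q * e ^ (j - q) =
      grid (i + 1) j - grid i j * e := by
  induction j with
  | zero =>
    simp only [zero_add, Finset.sum_range_one, gridIncr, grid, gridStep, Nat.sub_self, c_eq]
    rw [if_neg (by omega)]
    noncomm_ring
  | succ j ih =>
    have h : ∑ q ∈ Finset.range (j + 1), gridIncr (i + 1) q * e ^ (j + 1 - q) =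
        (∑ q ∈ Finset.range (j + 1), gridIncr (i + 1) q * e ^ (j - q)) * e := by
      rw [Finset.sum_mul]
      refine Finset.sum_congr rfl fun q hq => ?_
      rw [Finset.mem_range] at hq
      rw [mul_assoc, ← pow_succ, show j + 1 - q = j - q + 1 by omega]
    rw [Finset.sum_range_succ, h, ih]
    simp only [gridIncr, gridStep, Nat.sub_self]
    rw [if_neg (by omega), grid, c_eq]
    noncomm_ring

/-- `grid` is obtained by summing its increments. -/
theorem grid_eq_sum (i j : ℕ) :
    ∑ p ∈ Finset.range (i + 1), ∑ q ∈ Finset.range (j + 1),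
      gridIncr p q * e ^ (i + j - (p + q)) = grid i j := by
  induction i with
  | zero =>
    rw [zero_add, Finset.sum_range_one, ← row_sum_zero]
    simp
  | succ i ih =>
    rw [Finset.sum_range_succ, ← sub_add_cancel (grid (i + 1) j) (grid i j * e), ← row_sum_succ,
      ← ih, add_comm, Finset.sum_mul]
    congr 1
    · refine Finset.sum_congr rfl fun q _ => ?_
      rw [show i + 1 + j - (i + 1 + q) = j - q by omega]
    · refine Finset.sum_congr rfl fun p hp => ?_
      rw [Finset.sum_mul]
      refine Finset.sum_congr rfl fun q hq => ?_
      rw [Finset.mem_range] at hp hq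
      rw [mul_assoc, ← pow_succ, show i + 1 + j - (p + q) = i + j - (p + q) + 1 by omega]

/-- The sum of `grid` over the `n`-th antidiagonal. -/
def gridSum (n : ℕ) : ABPoly := ∑ p ∈ Finset.HasAntidiagonal.antidiagonal n, grid p.1 p.2

/-- Each cell of the n-th antidiagonal has two successors on the next one, so it is counted twice.
-/
theorem sum_gridStep (n : ℕ) :
    ∑ p ∈ Finset.HasAntidiagonal.antidiagonal (n + 1), gridStep p.1 p.2 = 2 * gridSum n := by
  have h1 : ∑ p ∈ Finset.HasAntidiagonal.antidiagonal (n + 1), gridStep p.1 p.2 =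
      ∑ p ∈ Finset.HasAntidiagonal.antidiagonal n, grid p.1 p.2 +
      ∑ p ∈ Finset.HasAntidiagonal.antidiagonal n, grid p.1 p.2 := by
    cases n with
    | zero => simp [Finset.Nat.antidiagonal_succ, gridStep]
    | succ n =>
      rw [Finset.Nat.sum_antidiagonal_succ, Finset.Nat.sum_antidiagonal_succ']
      conv_rhs =>
        congr
        · rw [Finset.Nat.sum_antidiagonal_succ']
        · rw [Finset.Nat.sum_antidiagonal_succ]
      simp only [gridStep, Finset.sum_add_distrib]
      abel
  rw [h1, two_mul, gridSum]

theorem gridSum_add_two (n : ℕ) :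
    gridSum (n + 2) = gridSum (n + 1) * (2 * c) - gridSum n * e ^ 2 := by
  have h : gridSum (n + 2) =
      (∑ p ∈ Finset.HasAntidiagonal.antidiagonal (n + 2), gridStep p.1 p.2) * c -
        gridSum n * e ^ 2 := by
    rw [gridSum, Finset.Nat.sum_antidiagonal_succ, Finset.Nat.sum_antidiagonal_succ',
      Finset.Nat.sum_antidiagonal_succ (n := n + 1), Finset.Nat.sum_antidiagonal_succ' (n := n)]
    simp only [grid, gridStep, Finset.sum_add_distrib, Finset.sum_sub_distrib, add_mul,
      Finset.sum_mul, gridSum]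
    abel
  rw [h, sum_gridStep]
  noncomm_ring

theorem gridSum_eq_lucas (n : ℕ) : gridSum n = lucas n := by
  induction n using Nat.twoStepInduction with
  | zero => simp [gridSum, grid, lucas]
  | one => simp [gridSum, grid, lucas, Finset.Nat.antidiagonal_succ, two_mul]
  | more n ih1 ih2 => rw [gridSum_add_two, ih1, ih2, lucas_add_two']

end ABPoly

/-! ### Intervals of the ladder -/

namespace Ladder

open Classical

variable {n : ℕ} {x : Ladder n}

/-- The rank distance from the lower end of an interval to `x`. -/
def lo (v : IntervalsAround x) : ℕ := x.rk - v.1.fst.rk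

/-- The rank distance from `x` to the upper end of an interval. -/
def hi (v : IntervalsAround x) : ℕ := v.1.snd.rk - x.rk

theorem fst_le (v : IntervalsAround x) : v.1.fst ≤ x := (NonemptyInterval.le_def.1 v.2).1

theorem le_snd (v : IntervalsAround x) : x ≤ v.1.snd := (NonemptyInterval.le_def.1 v.2).2

theorem le_iff {v w : IntervalsAround x} : v ≤ w ↔ w.1.fst ≤ v.1.fst ∧ v.1.snd ≤ w.1.snd :=
  NonemptyInterval.le_def

/-- The member `[y, z]` of `IntervalsAround x`. -/
def mkAround {y z : Ladder n} (hy : y ≤ x) (hz : x ≤ z) : IntervalsAround x :=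
  ⟨⟨(y, z), hy.trans hz⟩, NonemptyInterval.le_def.2 ⟨hy, hz⟩⟩

theorem ext_around {v w : IntervalsAround x} (h1 : v.1.fst = w.1.fst) (h2 : v.1.snd = w.1.snd) :
    v = w := Subtype.ext (NonemptyInterval.ext (Prod.ext h1 h2))

instance : Fintype (IntervalsAround x) :=
  @Fintype.ofFinite _ (Finite.of_injective (fun v : IntervalsAround x => (v.1.fst, v.1.snd))
    fun _ _ h => ext_around (congrArg Prod.fst h) (congrArg Prod.snd h))

theorem strictMono_lo_add_hi : StrictMono fun v : IntervalsAround x => lo v + hi v := by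
  intro v w hvw
  obtain ⟨h1, h2⟩ := le_iff.1 hvw.le
  have h3 := rk_le_of_le h1
  have h4 := rk_le_of_le h2
  have h5 := rk_le_of_le (fst_le v)
  have h6 := rk_le_of_le (le_snd v)
  by_contra hlt
  simp only [lo, hi] at hlt
  refine hvw.ne (ext_around (eq_of_le_of_rk_eq h1 (by omega)).symm (eq_of_le_of_rk_eq h2 (by omega)))

theorem posetRank_around : (posetRank : IntervalsAround x → ℕ) = fun v => lo v + hi v := by
  refine posetRank_eq_of_strictMono strictMono_lo_add_hi fun v hv => ?_
  have h5 := rk_le_of_le (fst_le v)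
  have h6 := rk_le_of_le (le_snd v)
  -- Shrink the interval by one rank: at its upper end if the lower end is already `x`, otherwise at
  -- its lower end.
  rcases (fst_le v).eq_or_lt with h | h
  · have h' : x < v.1.snd := by
      rw [lt_iff]
      have := congrArg rk h
      simp only [lo, hi] at hv
      omega
    obtain ⟨z, h1, h2, h3⟩ := exists_le_pred h'
    refine ⟨mkAround (fst_le v) h1, lt_of_le_of_ne (le_iff.2 ⟨le_rfl, h2.le⟩) ?_, ?_⟩
    · intro he
      exact h2.ne (congrArg (fun u : IntervalsAround x => u.1.snd) he)
    · have := rk_le_of_le h1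
      change x.rk - v.1.fst.rk + (z.rk - x.rk) + 1 = x.rk - v.1.fst.rk + (v.1.snd.rk - x.rk)
      omega
  · obtain ⟨z, h1, h2, h3⟩ := exists_succ_le h
    refine ⟨mkAround h2 (le_snd v), lt_of_le_of_ne (le_iff.2 ⟨h1.le, le_rfl⟩) ?_, ?_⟩
    · intro he
      exact h1.ne' (congrArg (fun u : IntervalsAround x => u.1.fst) he)
    · have := rk_le_of_le h2
      change x.rk - z.rk + (v.1.snd.rk - x.rk) + 1 = x.rk - v.1.fst.rk + (v.1.snd.rk - x.rk)
      omega

/-- A sum over the intervals contained in `w` is a double sum over the two ends. -/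
theorem sum_around_le {A : Type*} [AddCommMonoid A] (w : IntervalsAround x) (f : ℕ → ℕ → A) :
    ∑ v ∈ Finset.univ.filter (· ≤ w), f (lo v) (hi v) =
      ∑ y ∈ Finset.univ.filter (fun y => w.1.fst ≤ y ∧ y ≤ x),
        ∑ z ∈ Finset.univ.filter (fun z => x ≤ z ∧ z ≤ w.1.snd),
          f (x.rk - y.rk) (z.rk - x.rk) := by
  rw [← Finset.sum_product']
  refine Finset.sum_nbij (fun v => (v.1.fst, v.1.snd)) ?_ ?_ ?_ fun _ _ => rfl
  · intro v hv
    have := le_iff.1 (Finset.mem_filter.1 hv).2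
    simp [this, fst_le v, le_snd v]
  · intro u _ v _ h
    exact ext_around (congrArg Prod.fst h) (congrArg Prod.snd h)
  · rintro ⟨y, z⟩ hyz
    simp only [Finset.coe_product, Set.mem_prod, Finset.mem_coe, Finset.mem_filter,
      Finset.mem_univ, true_and] at hyz
    obtain ⟨⟨h1, h2⟩, h3, h4⟩ := hyz
    exact ⟨mkAround h2 h3, by simpa using le_iff.2 ⟨h1, h4⟩, rfl⟩

/-- The weight `1` at `0` and `1/2` elsewhere. -/
def halfWeight (p : ℕ) : ℚ := if p = 0 then 1 else 2⁻¹

@[simp] theorem halfWeight_zero : halfWeight 0 = 1 := rfl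

@[simp] theorem halfWeight_succ (p : ℕ) : halfWeight (p + 1) = 2⁻¹ := rfl

/-- The sum of `F` below `i`, with weight `1/2` at `i` unless `i = 0`. -/
def halfSum (i : ℕ) (F : ℕ → ABPoly) : ABPoly :=
  ∑ p ∈ Finset.range i, F p + halfWeight i • F i

theorem halfSum_zero (F : ℕ → ABPoly) : halfSum 0 F = F 0 := by simp [halfSum]

/-- The factor 2 for the two elements at each intermediate distance cancels the weight 1/2; the far
end occurs once and keeps it. -/
theorem halfWeight_sum_Ioo (i : ℕ) (F : ℕ → ABPoly) :
    halfWeight 0 • F 0 + halfWeight (i + 1) • F (i + 1) +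
      2 • ∑ k ∈ Finset.Ioo 0 (i + 1), halfWeight k • F k = halfSum (i + 1) F := by
  have h : 2 • ∑ k ∈ Finset.Ioo 0 (i + 1), halfWeight k • F k =
      ∑ k ∈ Finset.range i, F (k + 1) := by
    rw [Finset.smul_sum, Finset.sum_bij' (i := fun k _ => k - 1) (j := fun k _ => k + 1)
      (t := Finset.range i) (g := fun k => F (k + 1))]
    · intro k hk
      have := Finset.mem_Ioo.1 hk
      exact Finset.mem_range.2 (by omega)
    · intro k hk
      have := Finset.mem_range.1 hk
      exact Finset.mem_Ioo.2 (by omega)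
    · intro k hk
      have := Finset.mem_Ioo.1 hk
      omega
    · intro k _
      omega
    · intro k hk
      have := Finset.mem_Ioo.1 hk
      obtain ⟨k, rfl⟩ : ∃ l, k = l + 1 := ⟨k - 1, by omega⟩
      simp only [halfWeight_succ, Nat.add_sub_cancel]
      module
  rw [h, halfSum, Finset.sum_range_succ', halfWeight_zero, one_smul]
  abel

theorem sum_down (F : ℕ → ABPoly) {y : Ladder n} (h : y ≤ x) :
    ∑ z ∈ Finset.univ.filter (fun z => y ≤ z ∧ z ≤ x),
      halfWeight (x.rk - z.rk) • F (x.rk - z.rk) = halfSum (x.rk - y.rk) F := by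
  rcases h.eq_or_lt with rfl | h
  · have : (Finset.univ.filter fun z => y ≤ z ∧ z ≤ y) = {y} := by
      ext z; simp [le_antisymm_iff, and_comm]
    simp [this, halfSum_zero]
  · have hxy := lt_iff.1 h
    rw [sum_between (fun k => halfWeight (x.rk - k) • F (x.rk - k)) h]
    obtain ⟨i, hi⟩ : ∃ i, x.rk - y.rk = i + 1 := ⟨x.rk - y.rk - 1, by omega⟩
    rw [hi, ← halfWeight_sum_Ioo, Nat.sub_self, add_comm (halfWeight (i + 1) • F (i + 1))]
    congr 2
    refine Finset.sum_bij' (fun k _ => x.rk - k) (fun k _ => x.rk - k) ?_ ?_ ?_ ?_ ?_ <;>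
      intro k hk <;> rw [Finset.mem_Ioo] at hk
    · exact Finset.mem_Ioo.2 (by omega)
    · exact Finset.mem_Ioo.2 (by omega)
    · omega
    · omega

theorem sum_up (F : ℕ → ABPoly) {y : Ladder n} (h : x ≤ y) :
    ∑ z ∈ Finset.univ.filter (fun z => x ≤ z ∧ z ≤ y),
      halfWeight (z.rk - x.rk) • F (z.rk - x.rk) = halfSum (y.rk - x.rk) F := by
  rcases h.eq_or_lt with rfl | h
  · have : (Finset.univ.filter fun z => x ≤ z ∧ z ≤ x) = {x} := by
      ext z; simp [le_antisymm_iff, and_comm]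
    simp [this, halfSum_zero]
  · have hxy := lt_iff.1 h
    rw [sum_between (fun k => halfWeight (k - x.rk) • F (k - x.rk)) h]
    obtain ⟨i, hi⟩ : ∃ i, y.rk - x.rk = i + 1 := ⟨y.rk - x.rk - 1, by omega⟩
    rw [hi, ← halfWeight_sum_Ioo, Nat.sub_self]
    congr 2
    refine Finset.sum_bij' (fun k _ => k - x.rk) (fun k _ => k + x.rk) ?_ ?_ ?_ ?_ ?_ <;>
      intro k hk <;> rw [Finset.mem_Ioo] at hk
    · exact Finset.mem_Ioo.2 (by omega)
    · exact Finset.mem_Ioo.2 (by omega)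
    · omega
    · omega

end Ladder

/-! ### The ab-index around an element and the total ab-index -/

namespace Ladder

open Classical ABPoly

variable {n : ℕ} {x : Ladder n}

theorem sum_around_le_halfWeight (w : IntervalsAround x) (F : ℕ → ℕ → ABPoly) :
    ∑ v ∈ Finset.univ.filter (· ≤ w), (halfWeight (lo v) * halfWeight (hi v)) • F (lo v) (hi v) =
      halfSum (lo w) fun p => halfSum (hi w) (F p) := by
  rw [sum_around_le w fun p q => (halfWeight p * halfWeight q) • F p q]
  simp only [mul_smul, ← Finset.smul_sum]
  simp only [sum_up _ (le_snd w)]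
  exact sum_down (fun p => halfSum (hi w) (F p)) (fst_le w)

/-- For positive `i`, `j` the weights are the average of the indicators of the boxes [0, i-1] × [0,
j] and [0, i] × [0, j-1], plus 1/4 at the corner (i, j). By `grid_eq_sum` the two boxes sum to the
two terms of `gridStep i j`. If `i` or `j` is 0, a single box remains. -/
theorem halfSum_halfSum_gridIncr {i j : ℕ} (h : 0 < i + j) :
    halfSum i (fun p => halfSum j fun q => gridIncr p q * e ^ (i + j - 1 - (p + q))) =
      (2 * halfWeight i * halfWeight j) • gridStep i j +
        (halfWeight i * halfWeight j) • gridIncr i j := by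
  set F : ℕ → ℕ → ABPoly := fun p q => gridIncr p q * e ^ (i + j - 1 - (p + q)) with hF
  -- At the corner the truncated subtraction gives the exponent 0.
  have hlast : F i j = gridIncr i j := by
    simp [hF, show i + j - 1 - (i + j) = 0 by omega]
  change halfSum i (fun p => halfSum j (F p)) = _
  rw [← hlast]
  cases i with
  | zero =>
    obtain ⟨j, rfl⟩ : ∃ k, j = k + 1 := ⟨j - 1, by omega⟩
    have h1 : ∑ q ∈ Finset.range (j + 1), F 0 q = grid 0 j := by
      rw [← grid_eq_sum, zero_add, Finset.sum_range_one]
      refine Finset.sum_congr rfl fun q _ => ?_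
      simp [hF]
    rw [halfSum_zero, halfSum, h1, gridStep]
    simp
  | succ i =>
    cases j with
    | zero =>
      have h1 : ∑ p ∈ Finset.range (i + 1), F p 0 = grid i 0 := by
        rw [← grid_eq_sum, zero_add]
        refine Finset.sum_congr rfl fun p _ => ?_
        simp [hF]
      simp only [halfSum_zero]
      rw [halfSum, h1, gridStep]
      simp
    | succ j =>
      have h1 : ∑ p ∈ Finset.range (i + 1), ∑ q ∈ Finset.range (j + 1 + 1), F p q =
          grid i (j + 1) := by
        rw [← grid_eq_sum]
        refine Finset.sum_congr rfl fun p _ => Finset.sum_congr rfl fun q _ => ?_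
        simp only [hF, show i + 1 + (j + 1) - 1 = i + (j + 1) by omega]
      have h2 : ∑ p ∈ Finset.range (i + 1 + 1), ∑ q ∈ Finset.range (j + 1), F p q =
          grid (i + 1) j := by
        rw [← grid_eq_sum]
        refine Finset.sum_congr rfl fun p _ => Finset.sum_congr rfl fun q _ => ?_
        simp only [hF, show i + 1 + (j + 1) - 1 = i + 1 + j by omega]
      simp only [Finset.sum_range_succ _ (j + 1), Finset.sum_add_distrib] at h1
      rw [Finset.sum_range_succ] at h2
      simp only [halfSum, Finset.sum_add_distrib, ← Finset.smul_sum, halfWeight_succ, gridStep]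
      rw [← h1, ← h2]
      module

theorem two_eq_smul_one : (2 : ABPoly) = (2 : ℚ) • (1 : ABPoly) := by
  rw [two_smul, one_add_one_eq_two]

/-- The `ab`-index of the lower interval of `w` in `IntervalsAround x`. -/
theorem chainSum_around (w : IntervalsAround x) (hw : 0 < lo w + hi w) :
    chainSum posetRank (a - b) b w =
      (2 * halfWeight (lo w) * halfWeight (hi w)) • gridStep (lo w) (hi w) := by
  have hr : StrictMono (posetRank : IntervalsAround x → ℕ) :=
    posetRank_around (x := x) ▸ strictMono_lo_add_hi
  have hrank (v : IntervalsAround x) : posetRank v = lo v + hi v := congrFun posetRank_around v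
  induction hk : lo w + hi w using Nat.strong_induction_on generalizing w with
  | _ k ih =>
  -- For `v < w` of positive rank this is the contribution of `v` to the recursion for `w`. At the
  -- bottom element it is the term of the empty chain; at `w` itself it is a spurious corner term,
  -- to be cancelled.
  set F : IntervalsAround x → ABPoly := fun v => (halfWeight (lo v) * halfWeight (hi v)) •
    (gridIncr (lo v) (hi v) * e ^ (lo w + hi w - 1 - (lo v + hi v))) with hF
  have hpos : ∑ v ∈ Finset.univ.filter (fun v => 1 ≤ posetRank v ∧ v < w),
      chainSum posetRank (a - b) b v * b * (a - b) ^ (posetRank w - 1 - posetRank v) =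
      ∑ v ∈ Finset.univ.filter (fun v => 1 ≤ posetRank v ∧ v < w), F v := by
    refine Finset.sum_congr rfl fun v hv => ?_
    obtain ⟨hv1, hvw⟩ := (Finset.mem_filter.1 hv).2
    have hlt : lo v + hi v < lo w + hi w := strictMono_lo_add_hi hvw
    rw [hrank] at hv1
    rw [ih _ (hk ▸ hlt) v hv1 rfl, hrank, hrank]
    simp only [hF, gridIncr]
    rw [if_neg (by omega), e, two_eq_smul_one]
    simp only [smul_mul_assoc, one_mul, smul_smul]
    congr 1
    ring
  let o : IntervalsAround x := mkAround le_rfl le_rfl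
  have hlo : lo o = 0 := Nat.sub_self _
  have hhi : hi o = 0 := Nat.sub_self _
  have hbot (v : IntervalsAround x) : o ≤ v := le_iff.2 ⟨fst_le v, le_snd v⟩
  have how : o < w := lt_of_le_of_ne (hbot w) (by rintro h; rw [← h, hlo, hhi] at hw; omega)
  have hle : Finset.univ.filter (· ≤ w) =
      insert w (insert o (Finset.univ.filter fun v => 1 ≤ posetRank v ∧ v < w)) := by
    ext v
    simp only [Finset.mem_filter, Finset.mem_univ, true_and, Finset.mem_insert]
    constructor
    · intro hv
      rcases hv.eq_or_lt with h | h
      · exact Or.inl h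
      rcases (hbot v).eq_or_lt with h' | h'
      · exact Or.inr (Or.inl h'.symm)
      · exact Or.inr (Or.inr ⟨Nat.one_le_of_lt (hr h'), h⟩)
    · rintro (rfl | rfl | h)
      · exact le_rfl
      · exact how.le
      · exact h.2.le
  have hsum := sum_around_le_halfWeight w
    fun p q => gridIncr p q * e ^ (lo w + hi w - 1 - (p + q))
  rw [halfSum_halfSum_gridIncr hw, hle, Finset.sum_insert, Finset.sum_insert] at hsum
  · rw [chainSum_eq hr, hpos, hrank]
    simp only [hlo, hhi, halfWeight_zero, Nat.sub_zero, mul_one, one_smul, gridIncr, and_self,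
      if_true, one_mul, add_zero] at hsum
    rw [show lo w + hi w - 1 - (lo w + hi w) = 0 by omega, pow_zero, mul_one, add_comm] at hsum
    -- The cancelled summand is the corner term at `w`.
    exact add_right_cancel hsum
  · simp [hrank, hlo, hhi]
  · simp [how.ne']

theorem abIndex_around (x : Ladder n) :
    abIndex (IntervalsAround x) =
      halfWeight x.rk • (2 * halfWeight (n + 1 - x.rk)) • gridStep x.rk (n + 1 - x.rk) := by
  have hr : StrictMono (posetRank : IntervalsAround x → ℕ) :=
    posetRank_around (x := x) ▸ strictMono_lo_add_hi
  have hlo : lo (⊤ : IntervalsAround x) = x.rk := Nat.sub_zero _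
  have hhi : hi (⊤ : IntervalsAround x) = n + 1 - x.rk := congrArg (· - x.rk) rk_top
  have := x.rk_le
  rw [abIndex, upsilon_eq_chainSum hr, chainSum_around _ (by omega), hlo, hhi, smul_smul]
  congr 1
  ring

theorem totalABIndex_eq_lucas (n : ℕ) : totalABIndex (Ladder n) = 2 * lucas n := by
  have hlt : (⊥ : Ladder n) < ⊤ := lt_iff.2 (by rw [rk_bot, rk_top]; omega)
  have h := sum_between
    (fun k => halfWeight k • (2 * halfWeight (n + 1 - k)) • gridStep k (n + 1 - k)) hlt
  simp only [bot_le, le_top, and_self, Finset.filter_true, rk_bot, rk_top] at h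
  rw [halfWeight_sum_Ioo n fun k => (2 * halfWeight (n + 1 - k)) • gridStep k (n + 1 - k)] at h
  simp only [totalABIndex, abIndex_around]
  rw [h, ← gridSum_eq_lucas, ← sum_gridStep, Finset.Nat.sum_antidiagonal_eq_sum_range_succ_mk,
    Finset.sum_range_succ, halfSum]
  -- All weights have become 1: for k ≤ n the factor 2 cancels `halfWeight (n + 1 - k)`, and for k =
  -- n + 1 it cancels `halfWeight (n + 1)`.
  congr 1
  · refine Finset.sum_congr rfl fun k hk => ?_
    obtain ⟨l, hl⟩ : ∃ l, n + 1 - k = l + 1 :=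
      ⟨n - k, by have := Finset.mem_range.1 hk; omega⟩
    simp [hl]
  · simp

end Ladder

theorem mainTheorem11 (n : ℕ) :
    intervalOpII (ABPoly.c ^ n) = totalABIndex (Ladder n) ∧
    (∃ Φ : CDPoly, (∀ Φ' : CDPoly, cdToAB Φ' = intervalOpII (ABPoly.c ^ n) ↔ Φ' = Φ) ∧
      ∀ (r : ℕ) (k : Fin (r + 1) → ℕ), 2 * r + ∑ i, k i = n →
        wordCoeff (cdWord k) Φ = 2 ^ (r + 1) * ∏ i, ((k i : ℚ) + 1)) ∧
    (∃ Φ : CEPoly, (∀ Φ' : CEPoly, ceToAB Φ' = intervalOpII (ABPoly.c ^ n) ↔ Φ' = Φ) ∧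
      ∀ (r : ℕ) (k : Fin (r + 1) → ℕ), 2 * r + ∑ i, k i = n →
        wordCoeff (ceWord k) Φ = (-1) ^ r * 2 ^ (n + 1 - 2 * r)) := by
  rw [Ladder.totalABIndex_eq_lucas, ABPoly.intervalOpII_c_pow_eq_lucas]
  refine ⟨rfl, ⟨2 * CDPoly.lucas n, fun Φ' => ?_, fun r k h => ?_⟩,
    ⟨2 * CEPoly.lucas n, fun Φ' => ?_, fun r k h => ?_⟩⟩
  · have h2 : cdToAB (2 * CDPoly.lucas n) = 2 * ABPoly.lucas n := by
      rw [two_mul, map_add, CDPoly.cdToAB_lucas, two_mul]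
    rw [← h2, CDPoly.cdToAB_injective.eq_iff]
  · rw [wordCoeff_two_mul, CDPoly.wordCoeff_cdWord k h, pow_succ]
    ring
  · have h2 : ceToAB (2 * CEPoly.lucas n) = 2 * ABPoly.lucas n := by
      rw [two_mul, map_add, CEPoly.ceToAB_lucas, two_mul]
    rw [← h2, CEPoly.ceToAB_injective.eq_iff]
  · rw [wordCoeff_two_mul, CEPoly.wordCoeff_ceWord k h,
      show n + 1 - 2 * r = ∑ i, k i + 1 by omega, pow_succ]
    ring

end
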